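/- Let $(X,\mathcal{B}_X,\mu)$ be a probability space and let $T=(T^{(m,n)})_{(m,n)\in\mathbb{Z}^2}$ be an action of the additive group $\mathbb{Z}^2$ on $X$ by measure-preserving measurable transformations. Write $U_T^{(m,n)}f=f\circ T^{(m,n)}$ for $f$ in the complex Hilbert space $L^2(X,\mathcal{B}_X,\mu)$, with $\langle f,g\rangle=\int_X f\overline{g}\,d\mu$. Let $\vec v=(1,\beta)\in\mathbb{R}^2$, and for $b\in(0,\infty)$ and $k\in\mathbb{N}$ put $$\Lambda^{\vec v}(b)=\{(m,n)\in\mathbb{Z}^2:\ \beta m-b/2\le n\le \beta m+b/2\},\qquad \Lambda_k^{\vec v}(b)=\Lambda^{\vec v}(b)\cap([0,k-1]\times\mathbb{Z}).$$ Let $\mathcal{K}_\mu^{\vec v}$ be the $\vec v$-directional Kronecker algebra, i.e. the sub-$\sigma$-algebra of all $B\in\mathcal{B}_X$ such that the closure of $\{U_T^{(m,n)}1_B:(m,n)\in\Lambda^{\vec v}(c)\}$ is compact in $L^2(X,\mathcal{B}_X,\mu)$, where the width $c\in(0,\infty)$ may be chosen arbitrarily, and let $$WM^{\mu,\vec v}(X)=\{f\in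 L^2(X,\mathcal{B}_X,\mu):\ \mathbb{E}(f\mid\mathcal{K}_\mu^{\vec v})=0\ \ \mu\text{-a.e.}\}$$ be the set of $\vec v$-weak mixing functions. Then, for every $b\in(0,\infty)$ and every choice of $c\in(0,\infty)$, $$WM^{\mu,\vec v}(X)=\Big\{f\in L^2(X,\mathcal{B}_X,\mu):\ \text{for all } g\in L^2(X,\mathcal{B}_X,\mu),\ \lim_{k\to\infty}\frac{1}{\#\Lambda_k^{\vec v}(b)}\sum_{(m,n)\in\Lambda_k^{\vec v}(b)}\big|\langle U_T^{(m,n)}f,g\rangle\big|=0\Big\}.$$ -/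

import Mathlib

open MeasureTheory Filter Topology

noncomputable section

namespace DirectionalWeakMixing

/-- A measure-preserving action `v ↦ T^v` of the additive group `ℤ²` on `(X, μ)`: together with a
probability measure `μ` this is a `ℤ²`-measure preserving system. -/
structure MPAction {X : Type*} [MeasurableSpace X] (μ : Measure X) where
  /-- the transformation `T^{(m,n)}` -/
  toFun : ℤ × ℤ → X → X
  map_zero : ∀ x, toFun 0 x = x
  map_add : ∀ v w x, toFun (v + w) x = toFun v (toFun w x)
  measurePreserving : ∀ v, MeasurePreserving (toFun v) μ μ

/-- The strip `Λ^v(b) = {(m,n) ∈ ℤ² : βm - b/2 ≤ n ≤ βm + b/2}` in the direction `v = (1,β)`. -/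
def strip (β b : ℝ) : Set (ℤ × ℤ) :=
  {p | β * (p.1 : ℝ) - b / 2 ≤ (p.2 : ℝ) ∧ (p.2 : ℝ) ≤ β * (p.1 : ℝ) + b / 2}

/-- `Λ^v(b) ∩ ([0,k-1] × ℤ)` as a set. -/
def truncStripSet (β b : ℝ) (k : ℕ) : Set (ℤ × ℤ) :=
  strip β b ∩ (Set.Icc (0 : ℤ) ((k : ℤ) - 1) ×ˢ Set.univ)

theorem truncStripSet_finite (β b : ℝ) (k : ℕ) : (truncStripSet β b k).Finite := by
  have h : (⋃ m ∈ Set.Icc (0 : ℤ) ((k : ℤ) - 1),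
      (fun n : ℤ => (m, n)) '' Set.Icc ⌈β * (m : ℝ) - b / 2⌉ ⌊β * (m : ℝ) + b / 2⌋).Finite :=
    (Set.finite_Icc _ _).biUnion fun m _ => (Set.finite_Icc _ _).image _
  refine h.subset ?_
  rintro ⟨m, n⟩ ⟨⟨h1, h2⟩, hm, -⟩
  simp only [Set.mem_iUnion]
  exact ⟨m, hm, n, ⟨Int.ceil_le.2 h1, Int.le_floor.2 h2⟩, rfl⟩

/-- `Λ_k^v(b) = Λ^v(b) ∩ ([0,k-1] × ℤ)` as a finite set. -/
def truncStrip (β b : ℝ) (k : ℕ) : Finset (ℤ × ℤ) := (truncStripSet_finite β b k).toFinset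

section System

variable {X : Type*} [MeasurableSpace X] {μ : Measure X}

/-- The Koopman operator `U_T^{(m,n)} f = f ∘ T^{(m,n)}` on the complex space `L²(X, μ)`. -/
def koopman (T : MPAction μ) (v : ℤ × ℤ) (f : Lp ℂ 2 μ) : Lp ℂ 2 μ :=
  Lp.compMeasurePreserving (T.toFun v) (T.measurePreserving v) f

/-- The measurable set `B` has a relatively compact orbit
`{U_T^{(m,n)} 1_B : (m,n) ∈ Λ^v(b)}` in `L²(X, μ)`. -/
def IsKroneckerSet [IsFiniteMeasure μ] (T : MPAction μ) (β b : ℝ) (B : Set X) : Prop :=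
  ∃ hB : MeasurableSet B, IsCompact (closure
    ((fun v => koopman T v (indicatorConstLp 2 hB (measure_ne_top μ B) (1 : ℂ))) '' strip β b))

/-- The pseudo-distance between `U_T^v 1_B` and `U_T^w 1_B`. -/
theorem dist_koopman_indicator [IsFiniteMeasure μ] (T : MPAction μ) {B : Set X}
    (hB : MeasurableSet B) (v w : ℤ × ℤ) :
    dist (koopman T v (indicatorConstLp 2 hB (measure_ne_top μ B) (1 : ℂ)))
      (koopman T w (indicatorConstLp 2 hB (measure_ne_top μ B) (1 : ℂ)))
      = Real.sqrt (μ.real (symmDiff (T.toFun v ⁻¹' B) (T.toFun w ⁻¹' B))) := by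
  unfold koopman
  rw [Lp.indicatorConstLp_compMeasurePreserving, Lp.indicatorConstLp_compMeasurePreserving,
    dist_indicatorConstLp_eq_norm, norm_indicatorConstLp (by simp) (by simp),
    Real.sqrt_eq_rpow]
  simp

theorem isKroneckerSet_iff [IsFiniteMeasure μ] (T : MPAction μ) (β b : ℝ) (B : Set X) :
    IsKroneckerSet T β b B ↔ MeasurableSet B ∧ ∀ ε > 0, ∃ t : Set (ℤ × ℤ), t.Finite ∧
      ∀ v ∈ strip β b, ∃ w ∈ t,
        μ.real (symmDiff (T.toFun v ⁻¹' B) (T.toFun w ⁻¹' B)) < ε := by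
  constructor
  · rintro ⟨hB, hc⟩
    refine ⟨hB, fun ε hε => ?_⟩
    have htb := hc.totallyBounded.subset subset_closure
    obtain ⟨s, hs, hfin, hcov⟩ :=
      Metric.finite_approx_of_totallyBounded htb (Real.sqrt ε) (Real.sqrt_pos.2 hε)
    obtain ⟨t, -, htfin, rfl⟩ := (Set.exists_subset_image_finite_and
      (p := fun u => u = s)).1 ⟨s, hs, hfin, rfl⟩
    refine ⟨t, htfin, fun v hv => ?_⟩
    have := hcov (Set.mem_image_of_mem _ hv)
    simp only [Set.mem_iUnion, Metric.mem_ball] at this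
    obtain ⟨y, ⟨w, hw, rfl⟩, hy⟩ := this
    refine ⟨w, hw, ?_⟩
    rw [dist_koopman_indicator T hB] at hy
    exact (Real.sqrt_lt_sqrt_iff measureReal_nonneg).1 hy
  · rintro ⟨hB, h⟩
    refine ⟨hB, ?_⟩
    refine TotallyBounded.isCompact_of_isClosed (TotallyBounded.closure ?_) isClosed_closure
    rw [Metric.totallyBounded_iff]
    intro ε hε
    obtain ⟨t, htfin, ht⟩ := h (ε ^ 2) (by positivity)
    refine ⟨_, htfin.image
      (fun v => koopman T v (indicatorConstLp 2 hB (measure_ne_top μ B) (1 : ℂ))), ?_⟩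
    rintro _ ⟨v, hv, rfl⟩
    obtain ⟨w, hw, hlt⟩ := ht v hv
    simp only [Set.mem_iUnion, Metric.mem_ball]
    refine ⟨_, ⟨w, hw, rfl⟩, ?_⟩
    rw [dist_koopman_indicator T hB]
    exact (Real.sqrt_lt' hε).2 hlt

theorem IsKroneckerSet.compl [IsFiniteMeasure μ] {T : MPAction μ} {β b : ℝ} {B : Set X}
    (h : IsKroneckerSet T β b B) : IsKroneckerSet T β b Bᶜ := by
  rw [isKroneckerSet_iff] at h ⊢
  refine ⟨h.1.compl, fun ε hε => ?_⟩
  obtain ⟨t, ht, hc⟩ := h.2 ε hε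
  refine ⟨t, ht, fun v hv => ?_⟩
  obtain ⟨w, hw, hlt⟩ := hc v hv
  refine ⟨w, hw, ?_⟩
  rwa [Set.preimage_compl, Set.preimage_compl, compl_symmDiff_compl]

theorem IsKroneckerSet.union [IsFiniteMeasure μ] {T : MPAction μ} {β b : ℝ} {A B : Set X}
    (hA : IsKroneckerSet T β b A) (hB : IsKroneckerSet T β b B) :
    IsKroneckerSet T β b (A ∪ B) := by
  obtain ⟨hAm, hAc⟩ := hA
  obtain ⟨hBm, hBc⟩ := hB
  refine (isKroneckerSet_iff T β b _).2 ⟨hAm.union hBm, fun ε hε => ?_⟩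
  set gA := fun v => koopman T v (indicatorConstLp 2 hAm (measure_ne_top μ A) (1 : ℂ))
  set gB := fun v => koopman T v (indicatorConstLp 2 hBm (measure_ne_top μ B) (1 : ℂ))
  have htb : TotallyBounded ((fun v => (gA v, gB v)) '' strip β b) := by
    refine (hAc.prod hBc).totallyBounded.subset ?_
    rintro _ ⟨v, hv, rfl⟩
    exact ⟨subset_closure ⟨v, hv, rfl⟩, subset_closure ⟨v, hv, rfl⟩⟩
  have hε' : 0 < ε / 2 := by positivity
  obtain ⟨s, hs, hfin, hcov⟩ :=
    Metric.finite_approx_of_totallyBounded htb (Real.sqrt (ε / 2)) (Real.sqrt_pos.2 hε')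
  obtain ⟨t, -, htfin, rfl⟩ := (Set.exists_subset_image_finite_and
      (p := fun u => u = s)).1 ⟨s, hs, hfin, rfl⟩
  refine ⟨t, htfin, fun v hv => ?_⟩
  have := hcov (Set.mem_image_of_mem _ hv)
  simp only [Set.mem_iUnion, Metric.mem_ball] at this
  obtain ⟨y, ⟨w, hw, rfl⟩, hy⟩ := this
  refine ⟨w, hw, ?_⟩
  rw [Prod.dist_eq, max_lt_iff] at hy
  obtain ⟨h1, h2⟩ := hy
  replace h1 : dist (gA v) (gA w) < _ := h1
  replace h2 : dist (gB v) (gB w) < _ := h2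
  rw [dist_koopman_indicator T hAm, Real.sqrt_lt_sqrt_iff measureReal_nonneg] at h1
  rw [dist_koopman_indicator T hBm, Real.sqrt_lt_sqrt_iff measureReal_nonneg] at h2
  have hsub : symmDiff (T.toFun v ⁻¹' (A ∪ B)) (T.toFun w ⁻¹' (A ∪ B)) ⊆
      symmDiff (T.toFun v ⁻¹' A) (T.toFun w ⁻¹' A) ∪
        symmDiff (T.toFun v ⁻¹' B) (T.toFun w ⁻¹' B) := by
    intro x
    simp only [Set.mem_symmDiff, Set.mem_preimage, Set.mem_union]
    tauto
  have h3 := measureReal_mono (μ := μ) hsub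
  have h4 := measureReal_union_le (μ := μ) (symmDiff (T.toFun v ⁻¹' A) (T.toFun w ⁻¹' A))
    (symmDiff (T.toFun v ⁻¹' B) (T.toFun w ⁻¹' B))
  linarith

theorem IsKroneckerSet.empty [IsFiniteMeasure μ] (T : MPAction μ) (β b : ℝ) :
    IsKroneckerSet T β b (∅ : Set X) := by
  refine (isKroneckerSet_iff T β b _).2
    ⟨MeasurableSet.empty, fun ε hε => ⟨{0}, Set.finite_singleton _, fun v _ => ⟨0, rfl, ?_⟩⟩⟩
  simpa using hε

theorem IsKroneckerSet.iUnion [IsFiniteMeasure μ] {T : MPAction μ} {β b : ℝ} {B : ℕ → Set X}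
    (h : ∀ i, IsKroneckerSet T β b (B i)) : IsKroneckerSet T β b (⋃ i, B i) := by
  have hacc : ∀ n, IsKroneckerSet T β b (Set.accumulate B n) := by
    intro n
    induction n with
    | zero => simpa [Set.accumulate_zero_nat] using h 0
    | succ n ih => rw [Set.accumulate_succ]; exact ih.union (h (n + 1))
  have hm : MeasurableSet (⋃ i, B i) := MeasurableSet.iUnion fun i => (h i).1
  refine (isKroneckerSet_iff T β b _).2 ⟨hm, fun ε hε => ?_⟩
  have hlim : Tendsto (fun n => μ.real (Set.accumulate B n)) atTop (𝓝 (μ.real (⋃ i, B i))) :=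
    (ENNReal.tendsto_toReal (measure_ne_top _ _)).comp tendsto_measure_iUnion_accumulate
  obtain ⟨n, hn⟩ := ((tendsto_order.1 hlim).1 (μ.real (⋃ i, B i) - ε / 3) (by linarith)).exists
  have hnm := (hacc n).1
  have hnsub : Set.accumulate B n ⊆ ⋃ i, B i := Set.accumulate_subset_iUnion n
  have hR : μ.real ((⋃ i, B i) \ Set.accumulate B n) < ε / 3 := by
    rw [measureReal_sdiff hnsub hnm]
    linarith
  have hRm : MeasurableSet ((⋃ i, B i) \ Set.accumulate B n) := hm.diff hnm
  obtain ⟨t, ht, hc⟩ := ((isKroneckerSet_iff T β b _).1 (hacc n)).2 (ε / 3) (by linarith)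
  refine ⟨t, ht, fun v hv => ?_⟩
  obtain ⟨w, hw, hlt⟩ := hc v hv
  refine ⟨w, hw, ?_⟩
  set U := ⋃ i, B i
  set A := Set.accumulate B n
  have hpre : ∀ v, μ.real (T.toFun v ⁻¹' (U \ A)) = μ.real (U \ A) := fun v =>
    (T.measurePreserving v).measureReal_preimage hRm.nullMeasurableSet
  have hsub : symmDiff (T.toFun v ⁻¹' U) (T.toFun w ⁻¹' U) ⊆
      symmDiff (T.toFun v ⁻¹' A) (T.toFun w ⁻¹' A) ∪
        (T.toFun v ⁻¹' (U \ A) ∪ T.toFun w ⁻¹' (U \ A)) := by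
    intro x
    have h1 := @hnsub (T.toFun v x)
    have h2 := @hnsub (T.toFun w x)
    simp only [Set.mem_symmDiff, Set.mem_preimage, Set.mem_union, Set.mem_sdiff]
    tauto
  have h3 := measureReal_mono (μ := μ) hsub
  have h4 := measureReal_union_le (μ := μ) (symmDiff (T.toFun v ⁻¹' A) (T.toFun w ⁻¹' A))
    (T.toFun v ⁻¹' (U \ A) ∪ T.toFun w ⁻¹' (U \ A))
  have h5 := measureReal_union_le (μ := μ) (T.toFun v ⁻¹' (U \ A)) (T.toFun w ⁻¹' (U \ A))
  rw [hpre, hpre] at h5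
  linarith

/-- The directional Kronecker algebra: the `σ`-algebra of all measurable sets `B` such that the
closure of `{U_T^{(m,n)} 1_B : (m,n) ∈ Λ^v(b)}` is compact in `L²(X, μ)`. -/
@[reducible] def kroneckerAlgebra [IsFiniteMeasure μ] (T : MPAction μ) (β b : ℝ) : MeasurableSpace X where
  MeasurableSet' := IsKroneckerSet T β b
  measurableSet_empty := IsKroneckerSet.empty T β b
  measurableSet_compl _ h := h.compl
  measurableSet_iUnion _ h := IsKroneckerSet.iUnion h

/-- It is a sub-`σ`-algebra, so that conditional expectations on it are the genuine ones. -/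
theorem kroneckerAlgebra_le {X : Type*} [m0 : MeasurableSpace X] {μ : Measure X}
    [IsFiniteMeasure μ] (T : MPAction μ) (β b : ℝ) : kroneckerAlgebra T β b ≤ m0 :=
  fun _ h => h.1

/-- The set `WM^{μ,v}(X)` of directionally weak mixing functions: those `f ∈ L²(X, μ)` whose
conditional expectation on the directional Kronecker algebra vanishes almost everywhere. -/
def weakMixingFunctions [IsFiniteMeasure μ] (T : MPAction μ) (β b : ℝ) : Set (Lp ℂ 2 μ) :=
  {f | μ[f | kroneckerAlgebra T β b] =ᵐ[μ] 0}

end System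

end DirectionalWeakMixing

end

/-!
A function is directionally weak mixing exactly when it is orthogonal to all almost periodic
functions, because a Lipschitz function of an almost periodic function is again almost periodic and
such compositions approximate the indicators of its level sets.

Let `A` be the truncated strip, let `f` be orthogonal to all almost periodic vectors, and consider
`x_A = (#A)⁻¹ ∑_{v ∈ A} ⟪U^v f, g⟫ U^v f`. Any weak limit `x` of these bounded vectors is almost
periodic: by Cauchy-Schwarz `|⟪U^w x_A, z⟫|²` is at most a constant times the mean square
correlation of `f` with `z` over a slightly larger set, a quadratic form in `z` of trace at most
`‖f‖²` which does not depend on `w`. In the limit one form of finite trace controls the whole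
orbit of `x`, and off a finite-dimensional subspace such a form is small. Every `x_A` is
orthogonal to the almost periodic vectors, so `x = 0`, and `⟪x_A, g⟫ = (#A)⁻¹ ∑ |⟪g, U^v f⟫|²`
tends to `0`.
-/

noncomputable section

namespace DirectionalWeakMixing

section Hilbert

variable {𝕜 H : Type*} [RCLike 𝕜] [NormedAddCommGroup H] [InnerProductSpace 𝕜 H]

local notation "⟪" x ", " y "⟫" => inner 𝕜 x y

theorem totallyBounded_of_forall_approx {α : Type*} [PseudoMetricSpace α] {s : Set α}
    (h : ∀ ε > 0, ∃ t : Set α, TotallyBounded t ∧ ∀ x ∈ s, ∃ y ∈ t, dist x y < ε) :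
    TotallyBounded s := by
  refine Metric.totallyBounded_iff.2 fun ε hε => ?_
  obtain ⟨t, ht, hst⟩ := h (ε / 2) (half_pos hε)
  obtain ⟨u, hu, htu⟩ := Metric.totallyBounded_iff.1 ht (ε / 2) (half_pos hε)
  refine ⟨u, hu, fun x hx => ?_⟩
  obtain ⟨y, hy, hxy⟩ := hst x hx
  obtain ⟨z, hz, hyz⟩ := Set.mem_iUnion₂.1 (htu hy)
  exact Set.mem_iUnion₂.2 ⟨z, hz, (dist_triangle x y z).trans_lt
    ((add_lt_add hxy (Metric.mem_ball.1 hyz)).trans_eq (add_halves ε))⟩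

theorem exists_finset_forall_orthogonal_lt {q : H → ℝ} {C : ℝ}
    (hq : ∀ e : ℕ → H, Orthonormal 𝕜 e → ∀ n, ∑ i ∈ Finset.range n, q (e i) ≤ C)
    {η : ℝ} (hη : 0 < η) :
    ∃ s : Finset H, ∀ z, ‖z‖ = 1 → (∀ y ∈ s, ⟪y, z⟫ = 0) → q z < η := by
  by_contra! h
  have : Std.Symm fun x y : H => ⟪x, y⟫ = 0 := ⟨fun _ _ => inner_eq_zero_symm.1⟩
  obtain ⟨e, he, horth⟩ := exists_seq_of_forall_finset_exists'
    (fun z : H => ‖z‖ = 1 ∧ η ≤ q z) (fun x y => ⟪x, y⟫ = 0) fun s _ =>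
      let ⟨z, hz, hsz, hqz⟩ := h s
      ⟨z, ⟨hz, hqz⟩, hsz⟩
  obtain ⟨n, hn⟩ := exists_nat_gt (C / η)
  have hsum : n • η ≤ ∑ i ∈ Finset.range n, q (e i) := by
    simpa using Finset.card_nsmul_le_sum (Finset.range n) (fun i => q (e i)) η fun i _ => (he i).2
  rw [div_lt_iff₀ hη, ← nsmul_eq_mul] at hn
  exact (hn.trans_le hsum).not_ge (hq e ⟨fun i => (he i).1, horth⟩ n)

theorem norm_sub_starProjection_lt {E : Submodule 𝕜 H} [E.HasOrthogonalProjection] {x : H} {ε : ℝ}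
    (hε : 0 < ε) (h : ∀ z ∈ Eᗮ, ‖z‖ = 1 → ‖⟪x, z⟫‖ < ε) : ‖x - E.starProjection x‖ < ε := by
  set z := x - E.starProjection x with hz
  have hzE : z ∈ Eᗮ := E.sub_starProjection_mem_orthogonal x
  rcases eq_or_ne z 0 with h0 | h0
  · simpa [h0] using hε
  have hxz : ⟪x, z⟫ = (‖z‖ : 𝕜) ^ 2 := by
    rw [← inner_self_eq_norm_sq_to_K, hz, inner_sub_left _ _ (x - E.starProjection x),
      E.inner_right_of_mem_orthogonal (E.starProjection_apply_mem x) hzE, sub_zero]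
  have hnorm : ‖⟪x, ((‖z‖ : 𝕜)⁻¹) • z⟫‖ = ‖z‖ := by
    rw [inner_smul_right, hxz, pow_two, inv_mul_cancel_left₀ (by simpa using h0),
      RCLike.norm_ofReal, abs_norm]
  rw [← hnorm]
  exact h _ (Eᗮ.smul_mem _ hzE) (norm_smul_inv_norm h0)

theorem totallyBounded_of_norm_inner_sq_le {s : Set H} (hs : Bornology.IsBounded s)
    {q : H → ℝ} {C : ℝ}
    (hq : ∀ e : ℕ → H, Orthonormal 𝕜 e → ∀ n, ∑ i ∈ Finset.range n, q (e i) ≤ C)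
    (hsq : ∀ x ∈ s, ∀ z, ‖⟪x, z⟫‖ ^ 2 ≤ q z) : TotallyBounded s := by
  obtain ⟨r, hr⟩ := hs.exists_norm_le
  refine totallyBounded_of_forall_approx fun ε hε => ?_
  obtain ⟨t, ht⟩ := exists_finset_forall_orthogonal_lt hq (pow_pos hε 2)
  set E : Submodule 𝕜 H := Submodule.span 𝕜 t
  have : ProperSpace E := FiniteDimensional.proper 𝕜 E
  refine ⟨(↑) '' Metric.closedBall (0 : E) r,
    ((isCompact_closedBall (0 : E) r).image continuous_subtype_val).totallyBounded,
    fun x hx => ⟨E.starProjection x, ⟨⟨_, E.starProjection_apply_mem x⟩, ?_, rfl⟩, ?_⟩⟩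
  · rw [mem_closedBall_zero_iff]
    exact (E.norm_starProjection_apply_le x).trans (hr x hx)
  · rw [dist_eq_norm]
    refine norm_sub_starProjection_lt hε fun z hz hz1 => lt_of_pow_lt_pow_left₀ 2 hε.le ?_
    exact (hsq x hx z).trans_lt (ht z hz1 fun y hy => hz y (Submodule.subset_span hy))

theorem exists_tendsto_inner_of_norm_le [CompleteSpace H] {ι : Type*} (𝒰 : Ultrafilter ι)
    {x : ι → H} {M : ℝ} (hx : ∀ i, ‖x i‖ ≤ M) :
    ∃ y, ∀ z, Tendsto (fun i => ⟪x i, z⟫) 𝒰 (𝓝 ⟪y, z⟫) := by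
  set φ : ι → WeakDual 𝕜 H := fun i => StrongDual.toWeakDual (InnerProductSpace.toDual 𝕜 H (x i))
  have hφ : ∀ i, φ i ∈ WeakDual.toStrongDual ⁻¹' Metric.closedBall (0 : StrongDual 𝕜 H) M :=
    fun i => by simpa [φ] using hx i
  obtain ⟨ψ, -, hψ⟩ := (WeakDual.isCompact_closedBall (0 : StrongDual 𝕜 H) M).ultrafilter_le_nhds'
    (𝒰.map φ) (mem_map.2 (Eventually.of_forall hφ))
  refine ⟨(InnerProductSpace.toDual 𝕜 H).symm (WeakDual.toStrongDual ψ), fun z => ?_⟩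
  rw [InnerProductSpace.toDual_symm_apply]
  exact (WeakDual.eval_continuous z).continuousAt.tendsto.comp hψ

end Hilbert

section Representation

variable {𝕜 H G : Type*} [RCLike 𝕜] [NormedAddCommGroup H] [InnerProductSpace 𝕜 H]
  [AddCommGroup G] {U : Multiplicative G →* H →ₗᵢ[𝕜] H}

local notation "⟪" x ", " y "⟫" => inner 𝕜 x y

theorem apply_ofAdd_add (v w : G) (x : H) :
    U (.ofAdd (v + w)) x = U (.ofAdd v) (U (.ofAdd w) x) := by
  rw [ofAdd_add, map_mul, LinearIsometry.coe_mul, Function.comp_apply]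

theorem inner_apply_left (v : G) (x y : H) : ⟪U (.ofAdd v) x, y⟫ = ⟪x, U (.ofAdd (-v)) y⟫ := by
  rw [← (U (.ofAdd v)).inner_map_map x, ← apply_ofAdd_add, add_neg_cancel, ofAdd_zero, map_one,
    LinearIsometry.coe_one, id]

variable (U) in
/-- The vector `x` is almost periodic along `S` if its orbit over `S` is relatively compact; in a
complete space this is the total boundedness of the orbit. -/
def AlmostPeriodic (S : Set G) (x : H) : Prop :=
  TotallyBounded ((fun v => U (.ofAdd v) x) '' S)

namespace AlmostPeriodic

variable {S : Set G} {x : H}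

theorem apply (h : AlmostPeriodic U S x) (w : G) : AlmostPeriodic U S (U (.ofAdd w) x) := by
  have := TotallyBounded.image h (U (.ofAdd w)).isometry.uniformContinuous
  rw [Set.image_image] at this
  simpa only [AlmostPeriodic, ← apply_ofAdd_add, add_comm] using this

theorem of_finite_cover (h : AlmostPeriodic U S x) {S' : Set G} {F : Finset G}
    (hF : ∀ v ∈ S', ∃ w ∈ F, v - w ∈ S) : AlmostPeriodic U S' x := by
  refine TotallyBounded.subset ?_
    ((totallyBounded_biUnion F.finite_toSet).2 fun w _ => h.apply w)
  rintro _ ⟨v, hv, rfl⟩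
  obtain ⟨w, hw, hvw⟩ := hF v hv
  refine Set.mem_biUnion hw ⟨v - w, hvw, ?_⟩
  simp only [← apply_ofAdd_add, sub_add_cancel]

theorem of_forall_approx (h : ∀ ε > 0, ∃ y, AlmostPeriodic U S y ∧ dist x y < ε) :
    AlmostPeriodic U S x := by
  refine totallyBounded_of_forall_approx fun ε hε => ?_
  obtain ⟨y, hy, hxy⟩ := h ε hε
  refine ⟨_, hy, Set.forall_mem_image.2 fun v hv => ⟨_, Set.mem_image_of_mem _ hv, ?_⟩⟩
  rwa [(U (.ofAdd v)).dist_map]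

end AlmostPeriodic

variable (U) in
/-- The average over `v ∈ A` of the squared correlations `‖⟪g, U^v f⟫‖²`. -/
def meanSquare (A : Finset G) (f g : H) : ℝ :=
  (A.card : ℝ)⁻¹ * ∑ v ∈ A, ‖⟪g, U (.ofAdd v) f⟫‖ ^ 2

variable (U) in
/-- The average over `v ∈ A` of the vectors `⟪U^v f, g⟫ U^v f`; its inner product with `g` is
`meanSquare U A f g`. -/
def correlationVector (A : Finset G) (f g : H) : H :=
  (A.card : 𝕜)⁻¹ • ∑ v ∈ A, ⟪U (.ofAdd v) f, g⟫ • U (.ofAdd v) f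

variable {A A' : Finset G} {f g : H}

theorem average_le_of_forall_le {ι : Type*} {s : Finset ι} {a : ι → ℝ} {M : ℝ} (hM : 0 ≤ M)
    (ha : ∀ i ∈ s, a i ≤ M) : (s.card : ℝ)⁻¹ * ∑ i ∈ s, a i ≤ M := by
  rcases s.eq_empty_or_nonempty with rfl | hs
  · simpa using hM
  rw [inv_mul_le_iff₀ (by exact_mod_cast hs.card_pos), ← nsmul_eq_mul]
  exact Finset.sum_le_card_nsmul s a M ha

theorem norm_inner_apply_sq_le (v : G) (f g : H) :
    ‖⟪g, U (.ofAdd v) f⟫‖ ^ 2 ≤ ‖f‖ ^ 2 * ‖g‖ ^ 2 := by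
  have h := norm_inner_le_norm (𝕜 := 𝕜) g (U (.ofAdd v) f)
  rw [(U (.ofAdd v)).norm_map] at h
  rw [mul_comm, ← mul_pow]
  gcongr

theorem meanSquare_nonneg : 0 ≤ meanSquare U A f g := by
  unfold meanSquare
  positivity

theorem meanSquare_le : meanSquare U A f g ≤ ‖f‖ ^ 2 * ‖g‖ ^ 2 :=
  average_le_of_forall_le (by positivity) fun v _ => norm_inner_apply_sq_le v f g

theorem sum_meanSquare_orthonormal_le {e : ℕ → H} (he : Orthonormal 𝕜 e) (n : ℕ) :
    ∑ i ∈ Finset.range n, meanSquare U A f (e i) ≤ ‖f‖ ^ 2 := by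
  unfold meanSquare
  rw [← Finset.mul_sum, Finset.sum_comm]
  refine average_le_of_forall_le (by positivity) fun v _ => ?_
  exact (he.sum_inner_products_le _).trans_eq (by rw [(U (.ofAdd v)).norm_map])

theorem inner_correlationVector (z : H) : ⟪correlationVector U A f g, z⟫ =
    (A.card : 𝕜)⁻¹ * ∑ v ∈ A, ⟪g, U (.ofAdd v) f⟫ * ⟪U (.ofAdd v) f, z⟫ := by
  simp only [correlationVector, inner_smul_left, sum_inner, map_inv₀, map_natCast, inner_conj_symm]

theorem inner_correlationVector_self :
    ⟪correlationVector U A f g, g⟫ = (meanSquare U A f g : 𝕜) := by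
  rw [inner_correlationVector, meanSquare]
  push_cast
  congr 1
  refine Finset.sum_congr rfl fun v _ => ?_
  rw [← inner_conj_symm (U (.ofAdd v) f) g, RCLike.mul_conj]

theorem norm_inner_correlationVector_sq_le (z : H) :
    ‖⟪correlationVector U A f g, z⟫‖ ^ 2 ≤ meanSquare U A f g * meanSquare U A f z := by
  have hsum : ‖∑ v ∈ A, ⟪g, U (.ofAdd v) f⟫ * ⟪U (.ofAdd v) f, z⟫‖ ≤
      ∑ v ∈ A, ‖⟪g, U (.ofAdd v) f⟫‖ * ‖⟪z, U (.ofAdd v) f⟫‖ := by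
    refine (norm_sum_le _ _).trans_eq (Finset.sum_congr rfl fun v _ => ?_)
    rw [norm_mul, norm_inner_symm z]
  rw [inner_correlationVector, norm_mul, norm_inv, RCLike.norm_natCast, mul_pow, meanSquare,
    meanSquare, mul_mul_mul_comm, ← pow_two]
  gcongr
  exact (pow_le_pow_left₀ (norm_nonneg _) hsum 2).trans (Finset.sum_mul_sq_le_sq_mul_sq _ _ _)

theorem meanSquare_apply_neg_le {w : G} {C : ℝ} (hw : ∀ v ∈ A, w + v ∈ A')
    (hcard : (A'.card : ℝ) ≤ C * A.card) (z : H) :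
    meanSquare U A f (U (.ofAdd (-w)) z) ≤ C * meanSquare U A' f z := by
  have hsum : ∑ v ∈ A, ‖⟪U (.ofAdd (-w)) z, U (.ofAdd v) f⟫‖ ^ 2 ≤
      ∑ v ∈ A', ‖⟪z, U (.ofAdd v) f⟫‖ ^ 2 := by
    simp only [inner_apply_left, neg_neg, ← apply_ofAdd_add]
    have hmap : A.map (addLeftEmbedding w) ⊆ A' := fun v hv => by
      obtain ⟨u, hu, rfl⟩ := Finset.mem_map.1 hv
      exact hw u hu
    refine (Finset.sum_map A (addLeftEmbedding w)
      fun v => ‖⟪z, U (.ofAdd v) f⟫‖ ^ 2).symm.trans_le ?_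
    exact Finset.sum_le_sum_of_subset_of_nonneg hmap fun _ _ _ => by positivity
  rcases A.eq_empty_or_nonempty with rfl | ⟨v, hv⟩
  · have hA' : A' = ∅ := by simpa using hcard
    simp [meanSquare, hA']
  have hA : (0 : ℝ) < A.card := by exact_mod_cast Finset.card_pos.2 ⟨v, hv⟩
  have hA' : (0 : ℝ) < A'.card := by exact_mod_cast Finset.card_pos.2 ⟨_, hw v hv⟩
  have hinv : (A.card : ℝ)⁻¹ ≤ C * (A'.card : ℝ)⁻¹ := by
    rwa [← div_eq_mul_inv, le_div_iff₀ hA', inv_mul_le_iff₀ hA, mul_comm]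
  rw [meanSquare, meanSquare, ← mul_assoc]
  exact mul_le_mul hinv hsum (by positivity) ((by positivity : (0 : ℝ) ≤ _).trans hinv)

theorem norm_correlationVector_le : ‖correlationVector U A f g‖ ≤ ‖f‖ ^ 2 * ‖g‖ := by
  rw [correlationVector, norm_smul, norm_inv, RCLike.norm_natCast]
  refine (mul_le_mul_of_nonneg_left (norm_sum_le _ _) (by positivity)).trans ?_
  refine average_le_of_forall_le (by positivity) fun v _ => ?_
  rw [norm_smul, pow_two, mul_right_comm]
  have := norm_inner_le_norm (𝕜 := 𝕜) (U (.ofAdd v) f) g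
  simp only [(U (.ofAdd v)).norm_map] at this ⊢
  gcongr

theorem almostPeriodic_of_tendsto_inner_correlationVector {ι : Type*} {𝒰 : Ultrafilter ι}
    {A A' : ι → Finset G} {S : Set G} {C : NNReal}
    (hadd : ∀ w ∈ S, ∀ᶠ i in 𝒰, ∀ v ∈ A i, w + v ∈ A' i)
    (hcard : ∀ᶠ i in 𝒰, ((A' i).card : ℝ) ≤ C * (A i).card) {x : H}
    (hx : ∀ z, Tendsto (fun i => ⟪correlationVector U (A i) f g, z⟫) 𝒰 (𝓝 ⟪x, z⟫)) :
    AlmostPeriodic U S x := by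
  have hlim : ∀ z, ∃ r, Tendsto (fun i => meanSquare U (A' i) f z) 𝒰 (𝓝 r) := fun z =>
    let ⟨r, _, hr⟩ := (isCompact_Icc (a := (0 : ℝ))
      (b := ‖f‖ ^ 2 * ‖z‖ ^ 2)).ultrafilter_le_nhds' (𝒰.map fun i => meanSquare U (A' i) f z)
      (mem_map.2 (Eventually.of_forall fun i => ⟨meanSquare_nonneg, meanSquare_le⟩))
    ⟨r, hr⟩
  choose q hq using hlim
  set K := ‖f‖ ^ 2 * ‖g‖ ^ 2
  refine totallyBounded_of_norm_inner_sq_le (𝕜 := 𝕜) (q := fun z => K * (C * q z))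
    (C := K * (C * ‖f‖ ^ 2)) ?_ ?_ ?_
  · refine (Metric.isBounded_closedBall (x := (0 : H)) (r := ‖x‖)).subset ?_
    rintro _ ⟨w, -, rfl⟩
    simp
  · intro e he n
    have hsum : ∑ i ∈ Finset.range n, q (e i) ≤ ‖f‖ ^ 2 :=
      le_of_tendsto (tendsto_finsetSum _ fun i _ => hq (e i))
        (Eventually.of_forall fun _ => sum_meanSquare_orthonormal_le he n)
    rw [← Finset.mul_sum, ← Finset.mul_sum]
    gcongr
  · rintro _ ⟨w, hw, rfl⟩ z
    rw [inner_apply_left]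
    refine le_of_tendsto_of_tendsto ((hx _).norm.pow 2) (((hq z).const_mul (C : ℝ)).const_mul K) ?_
    filter_upwards [hadd w hw, hcard] with i hi hci
    calc _ ≤ _ := norm_inner_correlationVector_sq_le _
      _ ≤ _ := mul_le_mul meanSquare_le (meanSquare_apply_neg_le hi hci z) meanSquare_nonneg
        (by positivity)

theorem tendsto_meanSquare_zero [CompleteSpace H] {ι : Type*} {l : Filter ι}
    {A A' : ι → Finset G} {S : Set G} {C : NNReal}
    (hadd : ∀ w ∈ S, ∀ᶠ i in l, ∀ v ∈ A i, w + v ∈ A' i)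
    (hcard : ∀ᶠ i in l, ((A' i).card : ℝ) ≤ C * (A i).card)
    (hf : ∀ x, AlmostPeriodic U S x → ⟪x, f⟫ = 0) (g : H) :
    Tendsto (fun i => meanSquare U (A i) f g) l (𝓝 0) := by
  refine (tendsto_iff_ultrafilter _ _ _).2 fun 𝒰 h𝒰 => ?_
  obtain ⟨x, hx⟩ := exists_tendsto_inner_of_norm_le (𝕜 := 𝕜) 𝒰
    (x := fun i => correlationVector U (A i) f g) fun i => norm_correlationVector_le
  have hap : AlmostPeriodic U S x := almostPeriodic_of_tendsto_inner_correlationVector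
    (fun w hw => h𝒰 (hadd w hw)) (h𝒰 hcard) hx
  have hzero : ∀ i, ⟪correlationVector U (A i) f g, x⟫ = 0 := fun i => by
    rw [inner_correlationVector]
    refine mul_eq_zero_of_right _ (Finset.sum_eq_zero fun v _ => mul_eq_zero_of_right _ ?_)
    rw [inner_apply_left, inner_eq_zero_symm]
    exact hf _ (hap.apply _)
  have hx0 : x = 0 := by
    refine inner_self_eq_zero.1 (tendsto_nhds_unique (hx x) ?_)
    simp only [hzero, tendsto_const_nhds]
  have hmean : Tendsto (fun i => (meanSquare U (A i) f g : 𝕜)) 𝒰 (𝓝 0) := by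
    simpa only [inner_correlationVector_self, hx0, inner_zero_left] using hx g
  exact tendsto_zero_iff_norm_tendsto_zero.2 (by simpa using hmean.norm)

theorem average_norm_inner_apply_sq_le (A : Finset G) (f g : H) :
    (1 / (A.card : ℝ) * ∑ v ∈ A, ‖⟪g, U (.ofAdd v) f⟫‖) ^ 2 ≤ meanSquare U A f g := by
  rw [meanSquare, one_div, inv_mul_eq_div, inv_mul_eq_div]
  exact sum_div_card_sq_le_sum_sq_div_card

theorem tendsto_average_norm_inner_apply_zero [CompleteSpace H] {ι : Type*} {l : Filter ι}
    {A A' : ι → Finset G} {S : Set G} {C : NNReal}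
    (hadd : ∀ w ∈ S, ∀ᶠ i in l, ∀ v ∈ A i, w + v ∈ A' i)
    (hcard : ∀ᶠ i in l, ((A' i).card : ℝ) ≤ C * (A i).card)
    (hf : ∀ x, AlmostPeriodic U S x → ⟪x, f⟫ = 0) (g : H) :
    Tendsto (fun i => 1 / ((A i).card : ℝ) * ∑ v ∈ A i, ‖⟪g, U (.ofAdd v) f⟫‖) l (𝓝 0) := by
  have hsqrt := (tendsto_meanSquare_zero hadd hcard hf g).sqrt
  rw [Real.sqrt_zero] at hsqrt
  exact squeeze_zero (fun i => by positivity)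
    (fun i => Real.le_sqrt_of_sq_le (average_norm_inner_apply_sq_le _ _ _)) hsqrt

theorem norm_inner_le_sum_add {t : Finset H} {x : H} {v : G} {δ : ℝ}
    (h : ∃ y ∈ t, dist (U (.ofAdd v) x) y < δ) (f : H) :
    ‖⟪x, f⟫‖ ≤ ∑ y ∈ t, ‖⟪y, U (.ofAdd v) f⟫‖ + δ * ‖f‖ := by
  obtain ⟨y, hy, hxy⟩ := h
  have hsplit : ⟪x, f⟫ = ⟪y, U (.ofAdd v) f⟫ + ⟪U (.ofAdd v) x - y, U (.ofAdd v) f⟫ := by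
    rw [inner_sub_left, (U (.ofAdd v)).inner_map_map, add_sub_cancel]
  have herr : ‖⟪U (.ofAdd v) x - y, U (.ofAdd v) f⟫‖ ≤ δ * ‖f‖ := by
    refine (norm_inner_le_norm _ _).trans ?_
    rw [(U (.ofAdd v)).norm_map, ← dist_eq_norm]
    gcongr
  rw [hsplit]
  refine (norm_add_le _ _).trans (add_le_add ?_ herr)
  exact Finset.single_le_sum (f := fun y => ‖⟪y, U (.ofAdd v) f⟫‖) (fun _ _ => norm_nonneg _) hy

theorem norm_inner_le_sum_average_add {t : Finset H} {x : H} {δ : ℝ} (hA : A.Nonempty)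
    (h : ∀ v ∈ A, ∃ y ∈ t, dist (U (.ofAdd v) x) y < δ) (f : H) :
    ‖⟪x, f⟫‖ ≤
      ∑ y ∈ t, 1 / (A.card : ℝ) * ∑ v ∈ A, ‖⟪y, U (.ofAdd v) f⟫‖ + δ * ‖f‖ := by
  have hcard : (0 : ℝ) < A.card := by exact_mod_cast hA.card_pos
  have hsum := Finset.card_nsmul_le_sum A _ _ fun v hv => norm_inner_le_sum_add (h v hv) f
  rw [Finset.sum_add_distrib, Finset.sum_comm, Finset.sum_const, nsmul_eq_mul, nsmul_eq_mul,
    ← le_div_iff₀' hcard, add_div, mul_div_cancel_left₀ _ hcard.ne'] at hsum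
  rwa [← Finset.mul_sum, one_div_mul_eq_div]

theorem AlmostPeriodic.inner_eq_zero {ι : Type*} {l : Filter ι} [l.NeBot]
    {A : ι → Finset G} {S : Set G} (hne : ∀ᶠ i in l, (A i).Nonempty) (hAS : ∀ i, ↑(A i) ⊆ S)
    {x : H} (hx : AlmostPeriodic U S x)
    (hf : ∀ g, Tendsto (fun i => 1 / ((A i).card : ℝ) * ∑ v ∈ A i, ‖⟪g, U (.ofAdd v) f⟫‖) l (𝓝 0)) :
    ⟪x, f⟫ = 0 := by
  have hle : ∀ δ > 0, ‖⟪x, f⟫‖ ≤ δ * ‖f‖ := fun δ hδ => by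
    obtain ⟨t, ht, hcov⟩ := Metric.totallyBounded_iff.1 hx δ hδ
    lift t to Finset H using ht
    have hlim := (tendsto_finsetSum t fun y _ => hf y).add_const (δ * ‖f‖)
    rw [Finset.sum_const_zero, zero_add] at hlim
    refine ge_of_tendsto hlim ?_
    filter_upwards [hne] with i hi
    refine norm_inner_le_sum_average_add hi (fun v hv => ?_) f
    simpa using hcov (Set.mem_image_of_mem _ (hAS i hv))
  have hlim : Tendsto (fun δ : ℝ => δ * ‖f‖) (𝓝[>] 0) (𝓝 0) :=
    tendsto_nhdsWithin_of_tendsto_nhds (by simpa using tendsto_id.mul_const ‖f‖ (x := 𝓝 (0 : ℝ)))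
  exact norm_le_zero_iff.1 (ge_of_tendsto hlim (eventually_mem_nhdsWithin.mono hle))

end Representation

section Strip

variable {β b : ℝ}

/-- The signed vertical distance of a lattice point from the line of slope `β` through `0`. -/
def offset (β : ℝ) (v : ℤ × ℤ) : ℝ := (v.2 : ℝ) - β * (v.1 : ℝ)

theorem offset_add (β : ℝ) (v w : ℤ × ℤ) : offset β (v + w) = offset β v + offset β w := by
  simp only [offset, Prod.fst_add, Prod.snd_add, Int.cast_add]
  ring

theorem offset_sub (β : ℝ) (v w : ℤ × ℤ) : offset β (v - w) = offset β v - offset β w := by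
  simp only [offset, Prod.fst_sub, Prod.snd_sub, Int.cast_sub]
  ring

theorem abs_offset_round_le (β : ℝ) (m : ℤ) : |offset β (m, round (β * m))| ≤ 1 / 2 := by
  rw [offset, abs_sub_comm]
  exact abs_sub_round (β * m)

theorem mem_strip_iff {v : ℤ × ℤ} : v ∈ strip β b ↔ |offset β v| ≤ b / 2 := by
  simp only [strip, Set.mem_ofPred_eq, offset, abs_le]
  constructor <;> rintro ⟨h1, h2⟩ <;> constructor <;> linarith

theorem mem_truncStrip_iff {k : ℕ} {v : ℤ × ℤ} :
    v ∈ truncStrip β b k ↔ v ∈ strip β b ∧ 0 ≤ v.1 ∧ v.1 < k := by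
  simp only [truncStrip, Set.Finite.mem_toFinset, truncStripSet, Set.mem_inter_iff,
    Set.mem_prod, Set.mem_univ, and_true, Set.mem_Icc, Int.le_sub_one_iff]

theorem coe_truncStrip_subset_strip (k : ℕ) : (truncStrip β b k : Set (ℤ × ℤ)) ⊆ strip β b :=
  fun _ hv => (mem_truncStrip_iff.1 hv).1

theorem truncStrip_nonempty (hb : 0 ≤ b) {k : ℕ} (hk : 0 < k) : (truncStrip β b k).Nonempty :=
  ⟨0, mem_truncStrip_iff.2
    ⟨mem_strip_iff.2 (by simpa [offset] using div_nonneg hb zero_le_two), le_rfl,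
      Int.natCast_pos.2 hk⟩⟩

theorem exists_finset_forall_sub_mem_strip (β : ℝ) (hb : 0 < b) (c : ℝ) :
    ∃ F : Finset (ℤ × ℤ), ∀ v ∈ strip β c, ∃ w ∈ F, v - w ∈ strip β b := by
  have hIcc : offset β '' strip β c ⊆ Set.Icc (-(c / 2)) (c / 2) :=
    Set.image_subset_iff.2 fun _ hv => abs_le.1 (mem_strip_iff.1 hv)
  have htb := (totallyBounded_Icc (-(c / 2)) (c / 2)).subset hIcc
  obtain ⟨_, hs, hfin, hcov⟩ := Metric.finite_approx_of_totallyBounded htb (b / 2) (half_pos hb)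
  obtain ⟨F, -, hF, rfl⟩ := Set.exists_subset_image_finite_and.1 ⟨_, hs, hfin, rfl⟩
  refine ⟨hF.toFinset, fun v hv => ?_⟩
  obtain ⟨_, ⟨w, hw, rfl⟩, hvw⟩ := Set.mem_iUnion₂.1 (hcov (Set.mem_image_of_mem _ hv))
  refine ⟨w, hF.mem_toFinset.2 hw, mem_strip_iff.2 ?_⟩
  rw [offset_sub]
  exact (Metric.mem_ball.1 hvw).le

theorem exists_forall_exists_mem_strip_abs_sub_le (β : ℝ) (hb : 0 < b) :
    ∃ M : ℕ, ∀ m : ℤ, ∃ v ∈ strip β b, |m - v.1| ≤ M := by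
  obtain ⟨F, hF⟩ := exists_finset_forall_sub_mem_strip β hb 1
  refine ⟨F.sup fun w => w.1.natAbs, fun m => ?_⟩
  obtain ⟨w, hwF, hw⟩ := hF (m, round (β * m)) (mem_strip_iff.2 (abs_offset_round_le β m))
  refine ⟨_, hw, ?_⟩
  rw [Prod.fst_sub, sub_sub_cancel, Int.abs_eq_natAbs]
  exact_mod_cast Finset.le_sup (f := fun w : ℤ × ℤ => w.1.natAbs) hwF

theorem exists_le_mul_card_truncStrip (β : ℝ) (hb : 0 < b) :
    ∃ N : ℕ, ∀ k : ℕ, k ≤ N * (truncStrip β b k).card := by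
  obtain ⟨M, hM⟩ := exists_forall_exists_mem_strip_abs_sub_le β hb
  choose v hv hvM using hM
  refine ⟨4 * M + 1, fun k => ?_⟩
  rcases k.eq_zero_or_pos with rfl | hk
  · exact zero_le
  have hmaps : ∀ m ∈ Finset.Ico (M : ℤ) (k - M), v m ∈ truncStrip β b k := fun m hm => by
    have hm' := Finset.mem_Ico.1 hm
    have hdist := abs_le.1 (hvM m)
    exact mem_truncStrip_iff.2 ⟨hv m, by lia, by lia⟩
  have hfiber : ∀ u ∈ truncStrip β b k,
      ((Finset.Ico (M : ℤ) (k - M)).filter (v · = u)).card ≤ 2 * M + 1 := fun u _ => by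
    have hsub : (Finset.Ico (M : ℤ) (k - M)).filter (v · = u) ⊆
        Finset.Icc (u.1 - M) (u.1 + M) := fun m hm => by
      obtain ⟨-, rfl⟩ := Finset.mem_filter.1 hm
      have hdist := abs_le.1 (hvM m)
      exact Finset.mem_Icc.2 ⟨by lia, by lia⟩
    refine (Finset.card_le_card hsub).trans ?_
    rw [Int.card_Icc]
    lia
  have hcard := Finset.card_le_mul_card_image_of_maps_to hmaps _ hfiber
  rw [Int.card_Ico] at hcard
  have hpos := (truncStrip_nonempty (β := β) hb.le hk).card_pos
  nlinarith [Int.self_le_toNat ((k : ℤ) - M - M)]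

theorem card_truncStrip_le (β b : ℝ) (k : ℕ) :
    (truncStrip β b k).card ≤ (⌊b⌋₊ + 1) * k := by
  have hmaps : ∀ v ∈ truncStrip β b k, v.1 ∈ Finset.Ico (0 : ℤ) k := fun v hv =>
    Finset.mem_Ico.2 (mem_truncStrip_iff.1 hv).2
  have hfiber : ∀ m ∈ Finset.Ico (0 : ℤ) k,
      ((truncStrip β b k).filter (·.1 = m)).card ≤ ⌊b⌋₊ + 1 := fun m _ => by
    have hmem : ∀ v ∈ (truncStrip β b k).filter (·.1 = m),
        v.2 ∈ Finset.Icc ⌈β * m - b / 2⌉ ⌊β * m + b / 2⌋ := fun v hv => by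
      obtain ⟨hvΛ, rfl⟩ := Finset.mem_filter.1 hv
      obtain ⟨hlow, hupp⟩ := (mem_truncStrip_iff.1 hvΛ).1
      exact Finset.mem_Icc.2 ⟨Int.ceil_le.2 hlow, Int.le_floor.2 hupp⟩
    have hinj : Set.InjOn Prod.snd ((truncStrip β b k).filter (·.1 = m) : Set (ℤ × ℤ)) :=
      fun v hv w hw h => Prod.ext
        ((Finset.mem_filter.1 hv).2.trans (Finset.mem_filter.1 hw).2.symm) h
    refine (Finset.card_le_card_of_injOn Prod.snd hmem hinj).trans ?_
    have hlen : ⌊β * m + b / 2⌋ - ⌈β * m - b / 2⌉ ≤ ⌊b⌋ := by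
      refine Int.le_floor.2 ?_
      push_cast
      linarith [Int.floor_le (β * m + b / 2), Int.le_ceil (β * m - b / 2)]
    rw [Int.card_Icc, ← Int.floor_toNat]
    lia
  simpa using Finset.card_le_mul_card_image_of_maps_to hmaps _ hfiber

theorem exists_add_mem_and_card_le_mul (β : ℝ) (hb : 0 < b) (c : ℝ) :
    ∃ (A : ℕ → Finset (ℤ × ℤ)) (C : NNReal),
      (∀ w ∈ strip β c, ∀ᶠ k in atTop, ∀ v ∈ truncStrip β b k, w + v ∈ A k) ∧
      ∀ k, ((A k).card : ℝ) ≤ C * (truncStrip β b k).card := by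
  obtain ⟨N, hN⟩ := exists_le_mul_card_truncStrip β hb
  set p : ℕ → ℤ × ℤ := fun k => (k, round (β * (k : ℤ)))
  -- Adding `p k`, a point near the line, makes the first coordinates of `w + v` nonnegative.
  refine ⟨fun k => (truncStrip β (b + c + 1) (3 * k)).image (· - p k),
    ((⌊b + c + 1⌋₊ + 1) * (3 * N) : ℕ), fun w hw => ?_, fun k => ?_⟩
  · filter_upwards [eventually_ge_atTop w.1.natAbs] with k hk v hv
    obtain ⟨hv, hv0, hvk⟩ := mem_truncStrip_iff.1 hv
    refine Finset.mem_image.2 ⟨w + v + p k, mem_truncStrip_iff.2 ⟨mem_strip_iff.2 ?_, ?_, ?_⟩,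
      add_sub_cancel_right _ _⟩
    · rw [offset_add, offset_add]
      refine (abs_add_three _ _ _).trans ?_
      linarith [mem_strip_iff.1 hw, mem_strip_iff.1 hv, abs_offset_round_le β k]
    all_goals
      simp only [Prod.fst_add, p]
      lia
  · have hcard : ((truncStrip β (b + c + 1) (3 * k)).image (· - p k)).card ≤
        (⌊b + c + 1⌋₊ + 1) * (3 * N) * (truncStrip β b k).card :=
      calc _ ≤ _ := Finset.card_image_le
        _ ≤ (⌊b + c + 1⌋₊ + 1) * (3 * k) := card_truncStrip_le β _ _
        _ ≤ (⌊b + c + 1⌋₊ + 1) * (3 * (N * (truncStrip β b k).card)) := by gcongr; exact hN k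
        _ = _ := by ring
    exact_mod_cast hcard

end Strip

section Approximation

theorem exists_lipschitzWith_norm_indicator_sub_le (𝕜 : Type*) [RCLike 𝕜] {α : Type*}
    [PseudoEMetricSpace α] (F : Set α) {δ : ℝ} (hδ : 0 < δ) :
    ∃ (K : NNReal) (φ : α → 𝕜), LipschitzWith K φ ∧ (∀ z ∈ F, φ z = 0) ∧
      ∀ z, ‖Fᶜ.indicator 1 z - φ z‖ ≤ (Metric.thickening δ F \ F).indicator 1 z := by
  set τ : α → ℝ := fun z => thickenedIndicator hδ F z
  have hτ : LipschitzWith (1 * δ.toNNReal⁻¹) τ :=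
    NNReal.isometry_coe.lipschitz.comp (lipschitzWith_thickenedIndicator hδ F)
  refine ⟨_, fun z => ((1 - τ z : ℝ) : 𝕜), RCLike.lipschitzWith_ofReal.comp
    ((LipschitzWith.const 1).sub hτ), fun z hz => ?_, fun z => ?_⟩
  · simp only [τ, thickenedIndicator_one hδ F hz, NNReal.coe_one, sub_self, RCLike.ofReal_zero]
  by_cases hzF : z ∈ F
  · have hτ1 : τ z = 1 := congrArg NNReal.toReal (thickenedIndicator_one hδ F hzF)
    simp [hzF, hτ1]
  by_cases hzδ : z ∈ Metric.thickening δ F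
  · have hτ1 : |τ z| ≤ 1 := by
      rw [abs_of_nonneg (NNReal.coe_nonneg _)]
      exact_mod_cast thickenedIndicator_le_one hδ F z
    simpa [hzF, hzδ] using hτ1
  · have hτ0 : τ z = 0 := congrArg NNReal.toReal (thickenedIndicator_zero hδ F hzδ)
    simp [hzF, hzδ, hτ0]

variable {X : Type*} [MeasurableSpace X] {μ : Measure X}

theorem exists_measureReal_preimage_thickening_diff_lt [IsFiniteMeasure μ] {α : Type*}
    [PseudoEMetricSpace α] [MeasurableSpace α] [OpensMeasurableSpace α] {f : X → α}
    (hf : Measurable f) {F : Set α} (hF : IsClosed F) {ε : ℝ} (hε : 0 < ε) :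
    ∃ δ > 0, μ.real (f ⁻¹' (Metric.thickening δ F \ F)) < ε := by
  have h := (ENNReal.tendsto_toReal (measure_ne_top _ _)).comp
    (tendsto_measure_thickening_of_isClosed (μ := μ.map f) ⟨1, one_pos, measure_ne_top _ _⟩ hF)
  obtain ⟨δ, hδ, hδ0⟩ := ((h.eventually_lt_const (lt_add_of_pos_right _ hε)).and
    self_mem_nhdsWithin).exists
  refine ⟨δ, hδ0, ?_⟩
  have hmeas := (Metric.isOpen_thickening (δ := δ) (E := F)).measurableSet.diff hF.measurableSet
  rw [← map_measureReal_apply hf hmeas, measureReal_sdiff (Metric.self_subset_thickening hδ0 F)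
    hF.measurableSet, sub_lt_iff_lt_add']
  exact hδ

theorem norm_le_rpow_of_ae_norm_le_indicator {E : Type*} [NormedAddCommGroup E] {p : ENNReal}
    (hp : p ≠ 0) (hp' : p ≠ ⊤) {s : Set X} (hs : MeasurableSet s) (hμs : μ s ≠ ⊤)
    {f : Lp E p μ} (hf : ∀ᵐ x ∂μ, ‖f x‖ ≤ s.indicator 1 x) :
    ‖f‖ ≤ μ.real s ^ (1 / p.toReal) := by
  have h : ‖f‖ ≤ ‖indicatorConstLp p hs hμs (1 : ℝ)‖ := by
    refine Lp.norm_le_norm_of_ae_le ?_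
    filter_upwards [hf, indicatorConstLp_coeFn (p := p) (hs := hs) (hμs := hμs) (c := (1 : ℝ))]
      with x hx hx'
    rw [hx']
    exact hx.trans (le_abs_self _)
  simpa [norm_indicatorConstLp hp hp'] using h

end Approximation

section Koopman

variable {X : Type*} [MeasurableSpace X] {μ : Measure X}

/-- The Koopman representation of `ℤ²` on `L²(X, μ)`. -/
def koopmanRep (T : MPAction μ) : Multiplicative (ℤ × ℤ) →* Lp ℂ 2 μ →ₗᵢ[ℂ] Lp ℂ 2 μ where
  toFun v := Lp.compMeasurePreservingₗᵢ ℂ (T.toFun v.toAdd) (T.measurePreserving v.toAdd)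
  map_one' := by
    have h : T.toFun 0 = id := funext T.map_zero
    ext1 f
    simp only [toAdd_one, h]
    exact Lp.compMeasurePreserving_id_apply f
  map_mul' v w := by
    have h : T.toFun (v.toAdd + w.toAdd) = T.toFun w.toAdd ∘ T.toFun v.toAdd :=
      funext fun x => by rw [add_comm, T.map_add, Function.comp_apply]
    ext1 f
    simp only [toAdd_mul, h]
    exact Lp.compMeasurePreserving_comp_apply f (T.measurePreserving w.toAdd)
      (T.measurePreserving v.toAdd)

theorem koopmanRep_ofAdd_apply (T : MPAction μ) (v : ℤ × ℤ) (f : Lp ℂ 2 μ) :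
    koopmanRep T (.ofAdd v) f = koopman T v f := rfl

variable {T : MPAction μ} {β c : ℝ} {f : Lp ℂ 2 μ}

theorem isKroneckerSet_iff_almostPeriodic [IsFiniteMeasure μ] {B : Set X} :
    IsKroneckerSet T β c B ↔ ∃ hB : MeasurableSet B, AlmostPeriodic (koopmanRep T) (strip β c)
      (indicatorConstLp 2 hB (measure_ne_top μ B) (1 : ℂ)) :=
  exists_congr fun _ => ⟨fun h => h.totallyBounded.subset subset_closure,
    fun h => h.closure.isCompact_of_isClosed isClosed_closure⟩

theorem compLp_koopmanRep_apply {K : NNReal} {φ : ℂ → ℂ} (hφ : LipschitzWith K φ) (h0 : φ 0 = 0)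
    (v : Multiplicative (ℤ × ℤ)) (f : Lp ℂ 2 μ) :
    hφ.compLp h0 (koopmanRep T v f) = koopmanRep T v (hφ.compLp h0 f) := by
  rcases f with ⟨⟨_⟩, _⟩
  rfl

theorem AlmostPeriodic.compLp {S : Set (ℤ × ℤ)} (hf : AlmostPeriodic (koopmanRep T) S f)
    {K : NNReal} {φ : ℂ → ℂ} (hφ : LipschitzWith K φ) (h0 : φ 0 = 0) :
    AlmostPeriodic (koopmanRep T) S (hφ.compLp h0 f) := by
  have h := TotallyBounded.image hf (hφ.lipschitzWith_compLp h0 (p := 2) (μ := μ)).uniformContinuous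
  rw [Set.image_image] at h
  simpa only [AlmostPeriodic, compLp_koopmanRep_apply] using h

variable [IsFiniteMeasure μ]

theorem isKroneckerSet_preimage_of_zero_notMem
    (hf : AlmostPeriodic (koopmanRep T) (strip β c) f) {O : Set ℂ} (hO : IsOpen O)
    (h0 : (0 : ℂ) ∉ O) : IsKroneckerSet T β c (f ⁻¹' O) := by
  have hfm : Measurable f := (Lp.stronglyMeasurable f).measurable
  have hOm : MeasurableSet (f ⁻¹' O) := hfm hO.measurableSet
  refine isKroneckerSet_iff_almostPeriodic.2 ⟨hOm, .of_forall_approx fun ε hε => ?_⟩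
  obtain ⟨δ, hδ, hδε⟩ := exists_measureReal_preimage_thickening_diff_lt (μ := μ) hfm
    hO.isClosed_compl (sq_pos_of_pos hε)
  obtain ⟨K, φ, hφ, hφ0, hφδ⟩ := exists_lipschitzWith_norm_indicator_sub_le ℂ Oᶜ hδ
  have hφ0 : φ 0 = 0 := hφ0 0 h0
  refine ⟨hφ.compLp hφ0 f, hf.compLp hφ hφ0, ?_⟩
  have hshell : MeasurableSet (f ⁻¹' (Metric.thickening δ Oᶜ \ Oᶜ)) :=
    hfm (Metric.isOpen_thickening.measurableSet.diff hO.isClosed_compl.measurableSet)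
  rw [dist_eq_norm]
  refine (norm_le_rpow_of_ae_norm_le_indicator (by simp) (by simp) hshell
    (measure_ne_top μ _) ?_).trans_lt ?_
  · filter_upwards [Lp.coeFn_sub (indicatorConstLp 2 hOm (measure_ne_top μ _) (1 : ℂ))
      (hφ.compLp hφ0 f), hφ.coeFn_compLp hφ0 f,
      indicatorConstLp_coeFn (p := 2) (hs := hOm) (hμs := measure_ne_top μ _) (c := (1 : ℂ))]
      with x hsub hcomp hind
    rw [compl_compl] at hφδ
    rw [hsub, Pi.sub_apply, hcomp, hind]
    exact hφδ (f x)
  · rw [ENNReal.toReal_ofNat, ← Real.sqrt_eq_rpow]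
    exact (Real.sqrt_lt' hε).2 hδε

theorem AlmostPeriodic.measurable_kroneckerAlgebra
    (hf : AlmostPeriodic (koopmanRep T) (strip β c) f) :
    Measurable[kroneckerAlgebra T β c] (f : X → ℂ) := by
  refine @measurable_of_isOpen ℂ X _ _ _ (kroneckerAlgebra T β c) _ fun O hO => ?_
  change IsKroneckerSet T β c (f ⁻¹' O)
  by_cases h0 : (0 : ℂ) ∈ O
  · have hpunctured : IsKroneckerSet T β c (f ⁻¹' (O \ {0})) :=
      isKroneckerSet_preimage_of_zero_notMem hf (hO.sdiff isClosed_singleton) (by simp)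
    have hzero : IsKroneckerSet T β c (f ⁻¹' {0}) := by
      simpa using (isKroneckerSet_preimage_of_zero_notMem hf
        (isClosed_singleton (x := (0 : ℂ))).isOpen_compl (by simp)).compl
    rw [← Set.sdiff_union_of_subset (Set.singleton_subset_iff.2 h0)]
    exact hpunctured.union hzero
  · exact isKroneckerSet_preimage_of_zero_notMem hf hO h0

theorem inner_eq_zero_of_mem_weakMixingFunctions (hf : f ∈ weakMixingFunctions T β c) {g : Lp ℂ 2 μ}
    (hg : AlmostPeriodic (koopmanRep T) (strip β c) g) : inner ℂ g f = 0 := by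
  have hle := kroneckerAlgebra_le T β c
  have hgm : g ∈ lpMeas ℂ ℂ (kroneckerAlgebra T β c) 2 μ :=
    mem_lpMeas_iff_aestronglyMeasurable.2
      hg.measurable_kroneckerAlgebra.stronglyMeasurable.aestronglyMeasurable
  have hcond := (Lp.memLp f).condExpL2_ae_eq_condExp (𝕜 := ℂ) hle
  rw [Lp.toLp_coeFn] at hcond
  have hzero : condExpL2 ℂ ℂ hle f = 0 :=
    Subtype.ext (Lp.ext ((hcond.trans hf).trans (Lp.coeFn_zero ℂ 2 μ).symm))
  have : Fact (kroneckerAlgebra T β c ≤ ‹MeasurableSpace X›) := ⟨hle⟩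
  exact Submodule.orthogonalProjectionOnto_eq_zero_iff.1 hzero g hgm

theorem mem_weakMixingFunctions_of_forall_inner_eq_zero
    (h : ∀ g, AlmostPeriodic (koopmanRep T) (strip β c) g → inner ℂ g f = 0) :
    f ∈ weakMixingFunctions T β c := by
  refine (ae_eq_condExp_of_forall_setIntegral_eq (kroneckerAlgebra_le T β c)
    ((Lp.memLp f).integrable (by norm_num)) (fun s _ _ => integrableOn_zero)
    (fun B hB _ => ?_) aestronglyMeasurable_zero).symm
  obtain ⟨hBm, hap⟩ := isKroneckerSet_iff_almostPeriodic.1 (show IsKroneckerSet T β c B from hB)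
  simp only [integral_zero]
  rw [← L2.inner_indicatorConstLp_one hBm (measure_ne_top μ B), h _ hap]

theorem mem_weakMixingFunctions_iff : f ∈ weakMixingFunctions T β c ↔
    ∀ g, AlmostPeriodic (koopmanRep T) (strip β c) g → inner ℂ g f = 0 :=
  ⟨fun hf _ => inner_eq_zero_of_mem_weakMixingFunctions hf,
    mem_weakMixingFunctions_of_forall_inner_eq_zero⟩

end Koopman

end DirectionalWeakMixing

end

theorem theorem3p10_general {X : Type*} [MeasurableSpace X] (μ : MeasureTheory.Measure X)
    [MeasureTheory.IsFiniteMeasure μ] (T : DirectionalWeakMixing.MPAction μ) (β : ℝ)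
    (b : ℝ) (hb : 0 < b) (c : ℝ) (hc : 0 < c) :
    DirectionalWeakMixing.weakMixingFunctions T β c =
      {f : MeasureTheory.Lp ℂ 2 μ | ∀ g : MeasureTheory.Lp ℂ 2 μ,
        Filter.Tendsto
          (fun k : ℕ => (1 / ((DirectionalWeakMixing.truncStrip β b k).card : ℝ)) *
            ∑ v ∈ DirectionalWeakMixing.truncStrip β b k,
              ‖inner ℂ g (DirectionalWeakMixing.koopman T v f)‖)
          Filter.atTop (nhds 0)} := by
  open DirectionalWeakMixing in
  ext f
  simp only [mem_weakMixingFunctions_iff, Set.mem_ofPred_eq, ← koopmanRep_ofAdd_apply]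
  constructor
  · intro hf g
    obtain ⟨A, C, hadd, hcard⟩ := exists_add_mem_and_card_le_mul β hb c
    exact tendsto_average_norm_inner_apply_zero hadd (.of_forall hcard) hf g
  · intro hf g hg
    obtain ⟨F, hF⟩ := exists_finset_forall_sub_mem_strip β hc b
    have hne : ∀ᶠ k in atTop, (truncStrip β b k).Nonempty :=
      (eventually_gt_atTop 0).mono fun k hk => truncStrip_nonempty hb.le hk
    exact (hg.of_finite_cover hF).inner_eq_zero hne coe_truncStrip_subset_strip hf

theorem theorem3p10 {X : Type*} [MeasurableSpace X] (μ : MeasureTheory.Measure X)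
    [MeasureTheory.IsProbabilityMeasure μ] (T : DirectionalWeakMixing.MPAction μ) (β : ℝ)
    (b : ℝ) (hb : 0 < b) (c : ℝ) (hc : 0 < c) :
    DirectionalWeakMixing.weakMixingFunctions T β c =
      {f : MeasureTheory.Lp ℂ 2 μ | ∀ g : MeasureTheory.Lp ℂ 2 μ,
        Filter.Tendsto
          (fun k : ℕ => (1 / ((DirectionalWeakMixing.truncStrip β b k).card : ℝ)) *
            ∑ v ∈ DirectionalWeakMixing.truncStrip β b k,
              ‖inner ℂ g (DirectionalWeakMixing.koopman T v f)‖)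
          Filter.atTop (nhds 0)} :=
  theorem3p10_general μ T β b hb c hc
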